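/- Let $S$ be a semitopological semigroup (a semigroup with a topology for which multiplication is separately continuous), and let $X$ and $Y$ be compact Hausdorff spaces with separately continuous actions of $S$, on $X$ from the left and on $Y$ from the right. Let $\langle\cdot,\cdot\rangle: Y\times X\to[-1,1]$ be a strict $S$-duality, i.e. a separately continuous map with $\langle ys,x\rangle=\langle y,sx\rangle$ for all $y\in Y$, $s\in S$, $x\in X$, such that $y\mapsto\langle y,\cdot\rangle\in\mathbb R^X$ and $x\mapsto\langle\cdot,x\rangle\in\mathbb R^Y$ are topological embeddings for the pointwise topologies. Then there exist a reflexive real Banach space $V$, a map $h:S\to\Theta(V)=\{\sigma\in L(V,V):\|\sigma\|\le1\}$, and maps $\gamma_2:Y\to B(V)=\{v\in V:\|v\|\le 1\}$ and $\gamma_1:X\to B(V^*)=\{\varphi\in V^*:\|\varphi\|\le 1\}$ such that: 1. $h$ is an antihomomorphism, $h(st)=h(t)h(s)$, and is continuous for the weak operator topology on $\Theta(V)$; if $e$ is an identity element of $S$ that acts as the identity map on $X$ and on $Y$, then $h(e)=\mathrm{id}_V$. 2. $\gamma_2$ is a topological embedding for the weak topology on $B(V)$, and $\gamma_1$ is a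 topological embedding for the weak$^*$ topology on $B(V^*)$. 3. $\gamma_2(ys)=h(s)\gamma_2(y)$ and $\gamma_1(sx)=\gamma_1(x)\circ h(s)$ for all $s\in S$, $y\in Y$, $x\in X$. 4. $\gamma_1(x)(\gamma_2(y))=\langle y,x\rangle$ for all $y\in Y$, $x\in X$. 5. If the action $S\times X\to X$ is jointly continuous, then $h$ is continuous for the strong operator topology on $\Theta(V)$. In other words, the given duality is the $S$-restriction of the canonical reflexive duality $B(V)\times B(V^*)\to[-1,1]$ with the $S$-actions induced by $h$. -/

import Mathlib

universe u v w

open Topology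

namespace FlowDuality

/-- A left action of a topologized semigroup `S` on a space `X` is a *semitopological flow* if it
is separately continuous.  A right `S`-action is a left action of the opposite semigroup `Sᵐᵒᵖ`
(same topology), with `y * s` written `MulOpposite.op s • y`. -/
structure IsSemitopologicalFlow (S X : Type*) [TopologicalSpace S] [TopologicalSpace X]
    [SMul S X] : Prop where
  continuous_translation : ∀ s : S, Continuous fun x : X => s • x
  continuous_orbit : ∀ x : X, Continuous fun s : S => s • x

/-- `e` is a two-sided identity of the semigroup `S`. -/
def IsIdentity {S : Type*} [Semigroup S] (e : S) : Prop :=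
  ∀ s : S, e * s = s ∧ s * e = s

/-- A *duality* `Y × X → ℝ` is a separately continuous function. -/
structure IsDuality {Y X : Type*} [TopologicalSpace Y] [TopologicalSpace X]
    (w : Y → X → ℝ) : Prop where
  continuous_left : ∀ x : X, Continuous fun y : Y => w y x
  continuous_right : ∀ y : Y, Continuous fun x : X => w y x

/-- A duality is *right strict* if `x ↦ ⟨·, x⟩` is a topological embedding of `X` into the
functions on `Y` with the pointwise topology. -/
def IsRightStrict {Y X : Type*} [TopologicalSpace X] (w : Y → X → ℝ) : Prop :=
  IsEmbedding (fun (x : X) (y : Y) => w y x)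

/-- A duality is *left strict* if `y ↦ ⟨y, ·⟩` is a topological embedding of `Y` into the
functions on `X` with the pointwise topology. -/
def IsLeftStrict {Y X : Type*} [TopologicalSpace Y] (w : Y → X → ℝ) : Prop :=
  IsEmbedding (fun (y : Y) (x : X) => w y x)

/-- A strict `S`-duality: a left and right strict duality with `⟨y s, x⟩ = ⟨y, s x⟩`. -/
structure IsStrictSDuality (S : Type*) {Y X : Type*} [TopologicalSpace Y] [TopologicalSpace X]
    [SMul S X] [SMul Sᵐᵒᵖ Y] (w : Y → X → ℝ) : Prop where
  isDuality : IsDuality w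
  left_strict : IsLeftStrict w
  right_strict : IsRightStrict w
  invariant : ∀ (s : S) (y : Y) (x : X), w (MulOpposite.op s • y) x = w y (s • x)

section Banach

variable (V : Type*) [NormedAddCommGroup V] [NormedSpace ℝ V]

/-- `V` is reflexive: the canonical map into the bidual is onto. -/
def IsReflexiveSpace : Prop :=
  Function.Surjective (NormedSpace.inclusionInDoubleDual ℝ V)

/-- The closed unit ball `B(V)` with the weak topology. -/
abbrev WeakBall : Type _ := {v : WeakSpace ℝ V // ‖(toWeakSpace ℝ V).symm v‖ ≤ 1}

/-- The closed unit ball `B(V*)` of the dual with the weak-star topology. -/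
abbrev WeakStarBall : Type _ := {φ : WeakDual ℝ V // ‖WeakDual.toStrongDual φ‖ ≤ 1}

/-- The semigroup `Θ(V)` of all linear operators on `V` of norm at most one. -/
abbrev Theta : Type _ := {σ : V →L[ℝ] V // ‖σ‖ ≤ 1}

variable {V}

/-- The canonical duality `B(V) × B(V*) → ℝ`, `⟨v, φ⟩ = φ v`. -/
noncomputable def canonicalPairing (v : WeakBall V) (φ : WeakStarBall V) : ℝ :=
  WeakDual.toStrongDual φ.1 ((toWeakSpace ℝ V).symm v.1)

/-- The action of `Θ(V)` on `B(V)`, `v ↦ σ v`. -/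
noncomputable def ballAct (σ : Theta V) (v : WeakBall V) : WeakBall V :=
  ⟨toWeakSpace ℝ V (σ.1 ((toWeakSpace ℝ V).symm v.1)), by
    rw [LinearEquiv.symm_apply_apply]
    exact (σ.1.le_opNorm _).trans (mul_le_one₀ σ.2 (norm_nonneg _) v.2)⟩

/-- The dual action of `Θ(V)` on `B(V*)`, `φ ↦ φ ∘ σ`. -/
noncomputable def dualBallAct (σ : Theta V) (φ : WeakStarBall V) : WeakStarBall V :=
  ⟨StrongDual.toWeakDual ((WeakDual.toStrongDual φ.1).comp σ.1), by
    change ‖(WeakDual.toStrongDual φ.1).comp σ.1‖ ≤ 1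
    exact (ContinuousLinearMap.opNorm_comp_le _ _).trans (mul_le_one₀ φ.2 (norm_nonneg _) σ.2)⟩

/-- `h : S → Θ(V)` is an antihomomorphism: `h (s t) = h t ∘ h s`. -/
def IsAntihom {S : Type*} [Semigroup S] (h : S → Theta V) : Prop :=
  ∀ s t : S, (h (s * t)).1 = (h t).1.comp (h s).1

/-- Continuity of `h : S → Θ(V)` for the weak operator topology. -/
def WeaklyContinuous {S : Type*} [TopologicalSpace S] (h : S → Theta V) : Prop :=
  Continuous fun s : S => (ContinuousLinearMapWOT.ofCLM (h s).1 : V →WOT[ℝ] V)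

/-- Continuity of `h : S → Θ(V)` for the strong operator topology (pointwise norm convergence). -/
def StronglyContinuous {S : Type*} [TopologicalSpace S] (h : S → Theta V) : Prop :=
  Continuous fun s : S => ContinuousLinearMap.toPointwiseConvergenceCLM ℝ (RingHom.id ℝ) V V (h s).1

/-- `w : Y × X → ℝ` is an `S`-restriction, through `γ₂ : Y → B(V)` and `γ₁ : X → B(V*)`, of the
canonical duality `B(V) × B(V*) → [-1,1]`, on which `S` acts through `h`, from the right by
`v s = h(s) v` and from the left by `s φ = φ ∘ h(s)`: both maps are `S`-equivariant topological
embeddings for the weak and weak-star topologies, and they carry `w` to the canonical duality. -/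
structure IsSRestriction {S Y X : Type*} [TopologicalSpace Y] [TopologicalSpace X]
    [SMul S X] [SMul Sᵐᵒᵖ Y] (w : Y → X → ℝ) (h : S → Theta V)
    (γ₂ : Y → WeakBall V) (γ₁ : X → WeakStarBall V) : Prop where
  isEmbedding_left : IsEmbedding γ₂
  isEmbedding_right : IsEmbedding γ₁
  equivariant_left : ∀ (s : S) (y : Y), γ₂ (MulOpposite.op s • y) = ballAct (h s) (γ₂ y)
  equivariant_right : ∀ (s : S) (x : X), γ₁ (s • x) = dualBallAct (h s) (γ₁ x)
  pairing_eq : ∀ (y : Y) (x : X), canonicalPairing (γ₂ y) (γ₁ x) = w y x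

end Banach

end FlowDuality

/-! The space V is the Davis–Figiel–Johnson–Pełczyński interpolation space of a set K in C(X). Write
c x for F(·, x) in C(Y), and let K consist of the functions x ↦ ν(c x) with ν in the unit ball of
C(Y)*. Then K is convex and symmetric, contains every F(y, ·) (take ν to be evaluation at y), and is
invariant under f ↦ f(s ·), because F(ys, x) = F(y, sx) moves the translation from x to ν.

Grothendieck's theorem, used twice, makes K relatively weakly compact: once for c, so that the
members of K are continuous, and once for K itself, parametrised by the weak-star compact dual ball.
Hence the interpolation space between K and the unit ball is reflexive; it includes continuously
into C(X), and S acts on it by contractions.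

Now γ₂ y is F(y, ·), γ₁ x is evaluation at x, and h(s) is composition with translation by s, so the
identities hold by evaluating. Since the ball of V is weakly compact and evaluations separate
points, weak continuity of bounded maps into V can be tested on evaluations, where it is separate
continuity. If the action is jointly continuous, s ↦ f(s ·) is norm continuous in C(X), and
dominated convergence in the ℓ² sum carries this over to V. -/

/-! ### Functionals on C(X) and dominated convergence -/

open Filter MeasureTheory in
/-- Every bounded functional on `C(X)` is integration of `f ⊕ (-f)` against a finite measure
on `X ⊕ X`. -/
theorem ContinuousMap.exists_measure_sum_of_strongDual {X : Type*} [TopologicalSpace X]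
    [CompactSpace X] [T2Space X] [Nonempty X] [MeasurableSpace (X ⊕ X)] [BorelSpace (X ⊕ X)]
    (φ : StrongDual ℝ C(X, ℝ)) :
    ∃ μ : Measure (X ⊕ X), IsFiniteMeasure μ ∧
      ∀ f : C(X, ℝ), φ f = ∫ z, Sum.elim f (fun x => -f x) z ∂μ := by
  obtain ⟨x₀⟩ := ‹Nonempty X›
  let rl : C(X ⊕ X, ℝ) →L[ℝ] C(X, ℝ) :=
    ContinuousMap.compCLM ℝ ℝ ⟨Sum.inl, continuous_inl⟩
  let rr : C(X ⊕ X, ℝ) →L[ℝ] C(X, ℝ) :=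
    ContinuousMap.compCLM ℝ ℝ ⟨Sum.inr, continuous_inr⟩
  have hrl : ∀ F x, rl F x = F (Sum.inl x) := fun _ _ => rfl
  have hrr : ∀ F x, rr F x = F (Sum.inr x) := fun _ _ => rfl
  -- These are the antisymmetric functions, a copy of C(X), plus the constants.
  let S : Submodule ℝ C(X ⊕ X, ℝ) :=
    { carrier := {F | ∀ x, F (Sum.inl x) + F (Sum.inr x) = F (Sum.inl x₀) + F (Sum.inr x₀)}
      add_mem' := by
        intro a b ha hb x
        have h1 := ha x
        have h2 := hb x
        simp only [ContinuousMap.add_apply]; linarith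
      zero_mem' := by intro x; simp
      smul_mem' := by
        intro c a ha x
        have h1 := ha x
        simp only [ContinuousMap.smul_apply, smul_eq_mul]
        rw [← mul_add, h1, mul_add] }
  let ev : C(X ⊕ X, ℝ) →L[ℝ] ℝ :=
    ContinuousMap.evalCLM ℝ (Sum.inl x₀) + ContinuousMap.evalCLM ℝ (Sum.inr x₀)
  have hev : ∀ F, ev F = F (Sum.inl x₀) + F (Sum.inr x₀) := fun _ => rfl
  -- On `S` this is φ of the antisymmetric part plus ‖φ‖ times the constant part; the second term is
  -- there to make the extension positive.
  let l : C(X ⊕ X, ℝ) →L[ℝ] ℝ :=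
    (1 / 2 : ℝ) • φ.comp (rl - rr) + (‖φ‖ / 2) • ev
  have hl : ∀ F, l F = 1 / 2 * φ (rl F - rr F) + ‖φ‖ / 2 * ev F := fun F => by simp [l]
  obtain ⟨Λ, hΛl, hΛn⟩ := exists_extension_norm_eq S (l.comp S.subtypeL)
  have hn : ‖Λ‖ ≤ ‖φ‖ := by
    rw [hΛn]
    refine ContinuousLinearMap.opNorm_le_bound _ (norm_nonneg φ) fun F => ?_
    -- From |a - b| + |a + b| = 2 max(|a|, |b|), with a + b independent of the point on `S`.
    have h1 : ‖rl F.1 - rr F.1‖ ≤ 2 * ‖F‖ - |ev F.1| := by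
      have key : ∀ x, |F.1 (Sum.inl x) - F.1 (Sum.inr x)| ≤ 2 * ‖F‖ - |ev F.1| := by
        intro x
        have ha : |F.1 (Sum.inl x)| ≤ ‖F‖ := F.1.norm_coe_le_norm _
        have hb : |F.1 (Sum.inr x)| ≤ ‖F‖ := F.1.norm_coe_le_norm _
        rw [hev, ← F.2 x]
        rw [abs_le] at ha hb
        rcases abs_cases (F.1 (Sum.inl x) - F.1 (Sum.inr x)) with h | h <;>
        rcases abs_cases (F.1 (Sum.inl x) + F.1 (Sum.inr x)) with h' | h' <;> linarith
      rw [ContinuousMap.norm_le _ ((abs_nonneg _).trans (key x₀))]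
      exact key
    have h2 := φ.le_opNorm (rl F.1 - rr F.1)
    have h3 : ‖φ‖ * ‖rl F.1 - rr F.1‖ ≤ ‖φ‖ * (2 * ‖F‖ - |ev F.1|) := by gcongr
    change ‖l F.1‖ ≤ _
    rw [hl]
    calc ‖1 / 2 * φ (rl F.1 - rr F.1) + ‖φ‖ / 2 * ev F.1‖
        ≤ ‖1 / 2 * φ (rl F.1 - rr F.1)‖ + ‖‖φ‖ / 2 * ev F.1‖ := norm_add_le _ _
      _ = 1 / 2 * ‖φ (rl F.1 - rr F.1)‖ + ‖φ‖ / 2 * |ev F.1| := by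
          rw [norm_mul, norm_mul]
          simp [abs_of_nonneg (norm_nonneg φ)]
      _ ≤ _ := by linarith
  have hS1 : (1 : C(X ⊕ X, ℝ)) ∈ S := fun x => by simp
  have hΛ1 : Λ 1 = ‖φ‖ := by
    have := hΛl ⟨1, hS1⟩
    simp only at this
    rw [this]
    change l 1 = _
    rw [hl, show rl 1 - rr 1 = 0 from by ext; simp [hrl, hrr], hev]
    simp; ring
  -- A functional with ‖Λ‖ ≤ Λ 1 is positive: compare Λ at ‖F‖ · 1 - F, whose norm is at most ‖F‖.
  have hpos : ∀ F : C(X ⊕ X, ℝ), 0 ≤ F → 0 ≤ Λ F := by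
    intro F hF
    have h1 : ‖‖F‖ • (1 : C(X ⊕ X, ℝ)) - F‖ ≤ ‖F‖ := by
      rw [ContinuousMap.norm_le _ (norm_nonneg _)]
      intro z
      have h2 := F.norm_coe_le_norm z
      have h3 : 0 ≤ F z := hF z
      simp only [ContinuousMap.sub_apply, ContinuousMap.smul_apply, ContinuousMap.one_apply,
        smul_eq_mul, mul_one, Real.norm_eq_abs] at h2 ⊢
      rw [abs_le] at h2 ⊢
      constructor <;> linarith
    have h4 := (le_abs_self _).trans (Λ.le_opNorm (‖F‖ • (1 : C(X ⊕ X, ℝ)) - F))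
    rw [map_sub, map_smul, hΛ1, smul_eq_mul] at h4
    have h5 : ‖Λ‖ * ‖‖F‖ • (1 : C(X ⊕ X, ℝ)) - F‖ ≤ ‖φ‖ * ‖F‖ := by gcongr
    linarith
  let Λc : CompactlySupportedContinuousMap (X ⊕ X) ℝ →ₚ[ℝ] ℝ := PositiveLinearMap.mk₀
    { toFun := fun f => Λ f.toContinuousMap
      map_add' := fun f g => map_add Λ f.toContinuousMap g.toContinuousMap
      map_smul' := fun c f => map_smul Λ c f.toContinuousMap }
    (fun f hf => hpos _ hf)
  have hμf : IsFiniteMeasure (RealRMK.rieszMeasure Λc) := inferInstance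
  refine ⟨RealRMK.rieszMeasure Λc, hμf, fun f => ?_⟩
  let Jf : C(X ⊕ X, ℝ) := ⟨Sum.elim f (fun x => -f x), by fun_prop⟩
  have hJ := RealRMK.integral_rieszMeasure Λc (CompactlySupportedContinuousMap.continuousMapEquiv Jf)
  have hJ2 : Λc (CompactlySupportedContinuousMap.continuousMapEquiv Jf) = Λ Jf := rfl
  rw [hJ2] at hJ
  have hJS : Jf ∈ S := fun x => by simp [Jf]
  have hJ3 : Λ Jf = l Jf := hΛl ⟨Jf, hJS⟩
  rw [hl, hev, show rl Jf - rr Jf = (2 : ℝ) • f from by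
    ext x; simp only [ContinuousMap.sub_apply, hrl, hrr]; simp [Jf]; ring] at hJ3
  have h6 : φ f = Λ Jf := by rw [hJ3]; simp [Jf]
  rw [h6, ← hJ]
  rfl

open Filter MeasureTheory in
/-- Bounded pointwise convergent sequences in `C(X)` converge weakly. -/
theorem ContinuousMap.tendsto_strongDual_of_tendsto_pointwise {X : Type*} [TopologicalSpace X]
    [CompactSpace X] [T2Space X] (φ : StrongDual ℝ C(X, ℝ)) {f : ℕ → C(X, ℝ)} {g : C(X, ℝ)}
    {C : ℝ} (hC : ∀ n x, |f n x| ≤ C) (hf : ∀ x, Tendsto (fun n => f n x) atTop (𝓝 (g x))) :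
    Tendsto (fun n => φ (f n)) atTop (𝓝 (φ g)) := by
  rcases isEmpty_or_nonempty X with hX | hX
  · have : ∀ n, f n = g := fun n => by ext x; exact hX.elim x
    simp [this]
  let _ : MeasurableSpace (X ⊕ X) := borel _
  have : BorelSpace (X ⊕ X) := ⟨rfl⟩
  obtain ⟨μ, hμ, h⟩ := ContinuousMap.exists_measure_sum_of_strongDual φ
  simp only [h]
  refine tendsto_integral_of_dominated_convergence (fun _ => C) (fun n => ?_)
    (integrable_const _) (fun n => ?_) ?_
  · exact Continuous.aestronglyMeasurable (by fun_prop)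
  · refine Eventually.of_forall ?_
    rintro (x | x) <;> simpa using hC n x
  · refine Eventually.of_forall ?_
    rintro (x | x)
    · exact hf x
    · exact (hf x).neg

/-! ### Grothendieck's theorem on pointwise and weak compactness -/

theorem ContinuousMap.exists_finset_forall_abs_sub_lt {X : Type*} [TopologicalSpace X]
    [CompactSpace X] (T : Finset C(X, ℝ)) {δ : ℝ} (hδ : 0 < δ) :
    ∃ D : Finset X, ∀ x, ∃ x' ∈ D, ∀ f ∈ T, |f x - f x'| < δ := by
  have ho : ∀ x' : X, IsOpen {x | ∀ f ∈ T, |f x - f x'| < δ} := fun x' => by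
    have : {x | ∀ f ∈ T, |f x - f x'| < δ} = ⋂ f ∈ T, {x | |f x - f x'| < δ} := by ext; simp
    rw [this]
    exact isOpen_biInter_finset fun f _ => isOpen_lt (by fun_prop) continuous_const
  obtain ⟨D, hD⟩ := isCompact_univ.elim_finite_subcover _ ho fun x _ =>
    Set.mem_iUnion.2 ⟨x, fun f _ => by simpa using hδ⟩
  refine ⟨D, fun x => ?_⟩
  simpa using hD (Set.mem_univ x)

open Filter in
/-- Eberlein's construction: in a set of parameters accumulating at `y₀` there is a sequence along
which a separately continuous family converges pointwise. -/
theorem ContinuousMap.exists_seq_tendsto_of_frequently {Y X : Type*} [TopologicalSpace Y]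
    [CompactSpace Y] [TopologicalSpace X] [CompactSpace X] (Φ : Y → C(X, ℝ))
    (hΦ : ∀ x, Continuous fun y => Φ y x) {y₀ : Y} {p : Y → Prop} (hp : ∃ᶠ y in 𝓝 y₀, p y) :
    ∃ y : ℕ → Y, (∀ n, p (y n)) ∧ ∀ x, Tendsto (fun n => Φ (y n) x) atTop (𝓝 (Φ y₀ x)) := by
  classical
  have hpick : ∀ (D : Finset X) (n : ℕ), ∃ y, p y ∧ ∀ x ∈ D, |Φ y x - Φ y₀ x| < 1 / (n + 1) := by
    intro D n
    refine (hp.and_eventually ((Finset.eventually_all D).2 fun x _ => ?_)).exists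
    exact Metric.tendsto_nhds.1 ((hΦ x).tendsto y₀) (1 / (n + 1)) Nat.one_div_pos_of_nat
  have hnet : ∀ (T : Finset Y) (n : ℕ), ∃ D : Finset X,
      ∀ x, ∃ x' ∈ D, ∀ y ∈ T, |Φ y x - Φ y x'| < 1 / (n + 1) := by
    intro T n
    simpa using ContinuousMap.exists_finset_forall_abs_sub_lt (T.image Φ)
      (Nat.one_div_pos_of_nat (n := n) (α := ℝ))
  choose pick hpickp hpick using hpick
  choose net hnet using hnet
  -- A stage holds the parameters chosen so far and test points representing every x for those
  -- parameters. The next parameter is close to y₀ at the test points, and the net is then refined.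
  let st : ℕ → Finset Y × Finset X := fun n => Nat.rec ({y₀}, net {y₀} 0)
    (fun n q => (insert (pick q.2 n) q.1, q.2 ∪ net (insert (pick q.2 n) q.1) (n + 1))) n
  let y : ℕ → Y := fun n => pick (st n).2 n
  have st1 : ∀ n, (st (n + 1)).1 = insert (y n) (st n).1 := fun n => rfl
  have st2 : ∀ n, (st (n + 1)).2 = (st n).2 ∪ net (st (n + 1)).1 (n + 1) := fun n => rfl
  have m1 : Monotone fun n => (st n).1 := monotone_nat_of_le_succ fun n => by
    simp only [st1]; exact Finset.subset_insert _ _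
  have m2 : Monotone fun n => (st n).2 := monotone_nat_of_le_succ fun n => by
    rw [st2]; exact Finset.subset_union_left
  have hy0 : ∀ n, y₀ ∈ (st n).1 := fun n => m1 (Nat.zero_le n) (by simp [st])
  have hyn : ∀ j n, j < n → y j ∈ (st n).1 := fun j n h =>
    m1 (Nat.succ_le_of_lt h) (by simp only [Nat.succ_eq_add_one, st1]; simp)
  have hsub : ∀ n, net (st n).1 n ⊆ (st n).2 := by
    rintro (_ | n)
    · exact subset_rfl
    · rw [st2]; exact Finset.subset_union_right
  refine ⟨y, fun n => hpickp _ _, fun x => ?_⟩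
  choose x' hx'mem hx' using fun m => hnet (st m).1 m x
  -- The limit `xs` of the test points representing x is indistinguishable from x by y₀ and by every
  -- `y n`.
  obtain ⟨xs, -, hxs⟩ := isCompact_univ.ultrafilter_le_nhds
    (((hyperfilter ℕ : Ultrafilter ℕ)).map x') (by simp)
  have hxs : Tendsto x' (hyperfilter ℕ) (𝓝 xs) := hxs
  have hle : ((hyperfilter ℕ : Ultrafilter ℕ) : Filter ℕ) ≤ atTop := by
    rw [← Nat.cofinite_eq_atTop]; exact hyperfilter_le_cofinite
  have heq : ∀ (z : Y), (∀ᶠ m in atTop, z ∈ (st m).1) → Φ z x = Φ z xs := by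
    intro z hz
    have h1 : Tendsto (fun m => Φ z (x' m)) (hyperfilter ℕ) (𝓝 (Φ z xs)) :=
      ((Φ z).continuous.tendsto xs).comp hxs
    have h2 : Tendsto (fun m => Φ z (x' m)) atTop (𝓝 (Φ z x)) := by
      rw [tendsto_iff_dist_tendsto_zero]
      refine squeeze_zero' (Eventually.of_forall fun _ => dist_nonneg) ?_
        tendsto_one_div_add_atTop_nhds_zero_nat
      filter_upwards [hz] with m hm
      rw [dist_comm, Real.dist_eq]
      exact (hx' m z hm).le
    exact tendsto_nhds_unique (h2.mono_left hle) h1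
  have e0 : Φ y₀ x = Φ y₀ xs := heq _ (Eventually.of_forall hy0)
  have en : ∀ n, Φ (y n) x = Φ (y n) xs := fun n =>
    heq _ ((eventually_gt_atTop n).mono fun m hm => hyn n m hm)
  rw [tendsto_iff_ultrafilter]
  intro V hV
  obtain ⟨ys, -, hys⟩ := isCompact_univ.ultrafilter_le_nhds (V.map y) (by simp)
  have hys : Tendsto y V (𝓝 ys) := hys
  -- A cluster parameter `ys` agrees with y₀ at all test points, hence by continuity at `xs`; this
  -- is the exchange of limits.
  have hagree : ∀ m, Φ ys (x' m) = Φ y₀ (x' m) := by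
    intro m
    have h1 : Tendsto (fun n => Φ (y n) (x' m)) V (𝓝 (Φ ys (x' m))) :=
      ((hΦ (x' m)).tendsto ys).comp hys
    have h2 : Tendsto (fun n => Φ (y n) (x' m)) atTop (𝓝 (Φ y₀ (x' m))) := by
      rw [tendsto_iff_dist_tendsto_zero]
      refine squeeze_zero' (Eventually.of_forall fun _ => dist_nonneg) ?_
        tendsto_one_div_add_atTop_nhds_zero_nat
      filter_upwards [eventually_ge_atTop m] with n hn
      rw [Real.dist_eq]
      exact (hpick _ n _ (m2 hn (hsub m (hx'mem m)))).le
    exact tendsto_nhds_unique h1 (h2.mono_left hV)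
  have hfin : Φ ys xs = Φ y₀ xs := by
    have h1 := ((Φ ys).continuous.tendsto xs).comp hxs
    have h2 := ((Φ y₀).continuous.tendsto xs).comp hxs
    have h3 : (Φ ys) ∘ x' = (Φ y₀) ∘ x' := funext hagree
    rw [h3] at h1
    exact tendsto_nhds_unique h1 h2
  simp only [en, e0, ← hfin]
  exact ((hΦ xs).tendsto ys).comp hys

open Filter in
/-- **Grothendieck**: a bounded separately continuous family in `C(X)`, with compact parameter
space, is weakly continuous. -/
theorem ContinuousMap.continuous_strongDual_apply {Y X : Type*} [TopologicalSpace Y]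
    [CompactSpace Y] [TopologicalSpace X] [CompactSpace X] [T2Space X] (Φ : Y → C(X, ℝ))
    (hΦ : ∀ x, Continuous fun y => Φ y x) {C : ℝ} (hC : ∀ y x, |Φ y x| ≤ C)
    (ψ : StrongDual ℝ C(X, ℝ)) : Continuous fun y => ψ (Φ y) := by
  rw [continuous_iff_continuousAt]
  intro y₀
  by_contra hn
  rw [ContinuousAt, Metric.tendsto_nhds] at hn
  push Not at hn
  obtain ⟨ε, hε, hfr⟩ := hn
  obtain ⟨y, hy, hlim⟩ := ContinuousMap.exists_seq_tendsto_of_frequently Φ hΦ hfr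
  have h := ContinuousMap.tendsto_strongDual_of_tendsto_pointwise ψ (f := fun n => Φ (y n))
    (fun n x => hC _ x) hlim
  obtain ⟨n, hn⟩ := (Metric.tendsto_nhds.1 h ε hε).exists
  exact absurd hn (not_lt.2 (hy n))

/-! ### Relative weak compactness and the hull K -/

/-- Every ultrafilter on `K` converges weakly in the ambient normed space, i.e. `K` is relatively
weakly compact. -/
def IsRelWeaklyCompact {E : Type*} [NormedAddCommGroup E] [NormedSpace ℝ E] (K : Set E) : Prop :=
  ∀ U : Ultrafilter E, K ∈ U →
    ∃ κ : E, ∀ ψ : StrongDual ℝ E, Filter.Tendsto ψ U (𝓝 (ψ κ))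

section WeakHull

variable {G X : Type*} [NormedAddCommGroup G] [NormedSpace ℝ G] [TopologicalSpace X]

/-- The continuous functions `x ↦ ν (c x)` where `ν` ranges over the unit ball of the dual
of `G`. -/
def weakHull (c : X → G) : Set C(X, ℝ) :=
  {f | ∃ ν : StrongDual ℝ G, ‖ν‖ ≤ 1 ∧ ∀ x, f x = ν (c x)}

theorem convex_weakHull (c : X → G) : Convex ℝ (weakHull c) := by
  rintro f ⟨ν, hν, hf⟩ g ⟨μ, hμ, hg⟩ a b ha hb hab
  refine ⟨a • ν + b • μ, ?_, fun x => by simp [hf, hg]⟩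
  calc ‖a • ν + b • μ‖ ≤ ‖a • ν‖ + ‖b • μ‖ := norm_add_le _ _
    _ = a * ‖ν‖ + b * ‖μ‖ := by
      rw [norm_smul, norm_smul, Real.norm_of_nonneg ha, Real.norm_of_nonneg hb]
    _ ≤ a * 1 + b * 1 := by gcongr
    _ = 1 := by linarith

theorem neg_mem_weakHull {c : X → G} {f : C(X, ℝ)} (hf : f ∈ weakHull c) :
    -f ∈ weakHull c := by
  obtain ⟨ν, hν, hf⟩ := hf
  exact ⟨-ν, by rwa [norm_neg], fun x => by simp [hf]⟩

theorem zero_mem_weakHull (c : X → G) : (0 : C(X, ℝ)) ∈ weakHull c :=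
  ⟨0, by simp, fun x => by simp⟩

theorem norm_le_one_of_mem_weakHull [CompactSpace X] {c : X → G} (hc : ∀ x, ‖c x‖ ≤ 1)
    {f : C(X, ℝ)} (hf : f ∈ weakHull c) : ‖f‖ ≤ 1 := by
  obtain ⟨ν, hν, hf⟩ := hf
  rw [ContinuousMap.norm_le _ zero_le_one]
  intro x
  rw [hf]
  exact (ν.le_opNorm _).trans (mul_le_one₀ hν (norm_nonneg _) (hc x))

/-- The contraction `t` is absorbed by the functional, ν becoming ν ∘ t. This gives the S-invariance
of K. -/
theorem comp_mem_weakHull {c : X → G} {f : C(X, ℝ)} (hf : f ∈ weakHull c) (s : C(X, X))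
    (t : G →L[ℝ] G) (ht : ‖t‖ ≤ 1) (h : ∀ x, c (s x) = t (c x)) : f.comp s ∈ weakHull c := by
  obtain ⟨ν, hν, hf⟩ := hf
  refine ⟨ν.comp t, (ν.opNorm_comp_le t).trans (mul_le_one₀ hν (norm_nonneg _) ht), fun x => ?_⟩
  rw [ContinuousMap.comp_apply, hf, h]
  rfl

open Filter in
/-- The hull of a bounded weakly continuous family is relatively weakly compact. -/
theorem isRelWeaklyCompact_weakHull [CompactSpace X] [T2Space X] (c : X → G)
    (hcont : ∀ ν : StrongDual ℝ G, Continuous fun x => ν (c x)) (hc : ∀ x, ‖c x‖ ≤ 1) :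
    IsRelWeaklyCompact (weakHull c) := by
  let B := {ν : WeakDual ℝ G // ν ∈ WeakDual.toStrongDual ⁻¹' Metric.closedBall 0 1}
  have : CompactSpace B :=
    isCompact_iff_compactSpace.1 (WeakDual.isCompact_closedBall (0 : StrongDual ℝ G) 1)
  let Φ : B → C(X, ℝ) := fun ν => ⟨fun x => ν.1 (c x), hcont (WeakDual.toStrongDual ν.1)⟩
  have hB : ∀ ν : B, ‖WeakDual.toStrongDual ν.1‖ ≤ 1 := fun ν => by
    have := ν.2
    rwa [Set.mem_preimage, mem_closedBall_zero_iff] at this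
  have hΦmem : ∀ f ∈ weakHull c, ∃ ν : B, Φ ν = f := by
    rintro f ⟨ν, hν, hf⟩
    refine ⟨⟨StrongDual.toWeakDual ν, ?_⟩, by ext x; exact (hf x).symm⟩
    rw [Set.mem_preimage, mem_closedBall_zero_iff]
    exact hν
  -- Grothendieck's theorem with the weak-star compact dual ball as parameter space.
  have hΦcont : ∀ ψ : StrongDual ℝ C(X, ℝ), Continuous fun ν => ψ (Φ ν) := by
    refine ContinuousMap.continuous_strongDual_apply Φ
      (fun x => (WeakDual.eval_continuous (c x)).comp continuous_subtype_val) (C := 1) ?_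
    intro ν x
    exact ((WeakDual.toStrongDual ν.1).le_opNorm (c x)).trans
      (mul_le_one₀ (hB ν) (norm_nonneg _) (hc x))
  intro U hU
  obtain ⟨ν₀, -⟩ := hΦmem 0 (zero_mem_weakHull c)
  have hex : ∀ f, ∃ ν : B, f ∈ weakHull c → Φ ν = f := fun f => by
    by_cases hf : f ∈ weakHull c
    · obtain ⟨ν, h⟩ := hΦmem f hf
      exact ⟨ν, fun _ => h⟩
    · exact ⟨ν₀, fun h => absurd h hf⟩
  choose g hg using hex
  obtain ⟨ν, -, hν⟩ := isCompact_univ.ultrafilter_le_nhds (U.map g) (by simp)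
  have hν : Tendsto g U (𝓝 ν) := hν
  refine ⟨Φ ν, fun ψ => ?_⟩
  refine (((hΦcont ψ).tendsto ν).comp hν).congr' ?_
  filter_upwards [hU] with f hf
  simp [hg f hf]

end WeakHull

/-! ### Hahn–Banach separation and reflexivity -/

-- Mazur's theorem: a functional separating κ from the closed convex set would contradict the weak
-- limit.
open Filter in
theorem mem_closure_of_tendsto_strongDual {E : Type*} [NormedAddCommGroup E] [NormedSpace ℝ E]
    {A : Set E} (hA : Convex ℝ A) {l : Filter E} [l.NeBot] (hl : A ∈ l) {κ : E}
    (h : ∀ ψ : StrongDual ℝ E, Tendsto ψ l (𝓝 (ψ κ))) : κ ∈ closure A := by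
  by_contra hκ
  obtain ⟨ψ, u, h1, h2⟩ := geometric_hahn_banach_closed_point hA.closure isClosed_closure hκ
  refine absurd (le_of_tendsto (h ψ) (b := u) ?_) (not_le.2 h2)
  filter_upwards [hl] with a ha using (h1 a (subset_closure ha)).le

-- The functionals continuous for the weak topology of `B` are exactly those given by `D`, so the
-- hypothesis excludes a separation of ξ from `S`.
open Filter in
theorem exists_ultrafilter_tendsto_of_forall_le {W D : Type*} [AddCommGroup W] [Module ℝ W]
    [AddCommGroup D] [Module ℝ D] (B : W →ₗ[ℝ] D →ₗ[ℝ] ℝ) {S : Set W} (hS : Convex ℝ S) {ξ : W}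
    (h : ∀ d u, (∀ w ∈ S, B w d ≤ u) → B ξ d ≤ u) :
    ∃ U : Ultrafilter W, S ∈ U ∧ ∀ d, Tendsto (fun w => B w d) U (𝓝 (B ξ d)) := by
  let S' : Set (WeakBilin B) := S
  let ξ' : WeakBilin B := ξ
  have hcl : ξ' ∈ closure S' := by
    by_contra hn
    have hS' : Convex ℝ S' := hS
    obtain ⟨f, u, h1, h2⟩ := geometric_hahn_banach_closed_point hS'.closure isClosed_closure hn
    obtain ⟨d, rfl⟩ := LinearMap.dualEmbedding_surjective B f
    exact absurd (h d u fun w hw => (h1 w (subset_closure hw)).le) (not_le.2 h2)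
  obtain ⟨U, hU, hle⟩ := mem_closure_iff_ultrafilter.1 hcl
  exact ⟨U, hU, fun d => ((WeakBilin.eval_continuous B d).tendsto ξ').mono_left hle⟩

open Filter in
/-- **Goldstine's theorem**, in terms of ultrafilters. -/
theorem exists_ultrafilter_tendsto_of_norm_le_one {V : Type*} [NormedAddCommGroup V]
    [NormedSpace ℝ V] (ξ : StrongDual ℝ (StrongDual ℝ V)) (hξ : ‖ξ‖ ≤ 1) :
    ∃ U : Ultrafilter V, {v | ‖v‖ ≤ 1} ∈ U ∧
      ∀ φ : StrongDual ℝ V, Tendsto φ U (𝓝 (ξ φ)) := by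
  -- The separation takes place in the algebraic dual of V*, paired with V*; the ultrafilter is
  -- later pulled back along `J`.
  let J : V →ₗ[ℝ] StrongDual ℝ V →ₗ[ℝ] ℝ :=
    (ContinuousLinearMap.coeLM ℝ : StrongDual ℝ V →ₗ[ℝ] V →ₗ[ℝ] ℝ).flip
  let B : Set V := {v | ‖v‖ ≤ 1}
  have hB : Convex ℝ B := by
    simpa [Metric.closedBall, B] using convex_closedBall (0 : V) 1
  obtain ⟨U, hU, hlim⟩ := exists_ultrafilter_tendsto_of_forall_le
    (LinearMap.id : (StrongDual ℝ V →ₗ[ℝ] ℝ) →ₗ[ℝ] StrongDual ℝ V →ₗ[ℝ] ℝ)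
    (hB.linear_image J) (ξ := ξ.toLinearMap) (by
      intro φ u hu
      have hJ : ∀ v ∈ B, φ v ≤ u := fun v hv => hu (J v) ⟨v, hv, rfl⟩
      have hu0 : 0 ≤ u := by simpa using hJ 0 (by simp [B])
      have hn : ‖φ‖ ≤ u := by
        refine ContinuousLinearMap.opNorm_le_of_unit_norm hu0 fun v hv => ?_
        have e1 := hJ v hv.le
        have e2 := hJ (-v) (by simp [B, hv])
        rw [map_neg] at e2
        rw [Real.norm_eq_abs, abs_le]
        constructor <;> linarith
      have h3 : ξ φ ≤ 1 * ‖φ‖ := (le_abs_self _).trans (ξ.le_of_opNorm_le hξ φ)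
      exact h3.trans (by linarith))
  have hex : ∀ w, ∃ v : V, w ∈ J '' B → v ∈ B ∧ J v = w := fun w => by
    by_cases hw : w ∈ J '' B
    · obtain ⟨v, hv⟩ := hw
      exact ⟨v, fun _ => hv⟩
    · exact ⟨0, fun h => absurd h hw⟩
  choose g hg using hex
  refine ⟨U.map g, ?_, fun φ => ?_⟩
  · exact Ultrafilter.mem_map.2 (mem_of_superset hU fun w hw => (hg w hw).1)
  · rw [Ultrafilter.coe_map, tendsto_map'_iff]
    refine (hlim φ).congr' ?_
    filter_upwards [hU] with w hw
    exact congrArg (fun z => z φ) (hg w hw).2.symm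

open Filter in
/-- A normed space whose unit ball is weakly compact is reflexive. -/
theorem FlowDuality.isReflexiveSpace_of_ultrafilter {V : Type*} [NormedAddCommGroup V]
    [NormedSpace ℝ V] (h : ∀ U : Ultrafilter V, {v | ‖v‖ ≤ 1} ∈ U →
      ∃ v : V, ∀ φ : StrongDual ℝ V, Tendsto φ U (𝓝 (φ v))) :
    FlowDuality.IsReflexiveSpace V := by
  have key : ∀ ξ : StrongDual ℝ (StrongDual ℝ V), ‖ξ‖ ≤ 1 →
      ∃ v, NormedSpace.inclusionInDoubleDual ℝ V v = ξ := by
    intro ξ hξ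
    obtain ⟨U, hU, hlim⟩ := exists_ultrafilter_tendsto_of_norm_le_one ξ hξ
    obtain ⟨v, hv⟩ := h U hU
    exact ⟨v, ContinuousLinearMap.ext fun φ => tendsto_nhds_unique (hv φ) (hlim φ)⟩
  intro ξ
  rcases eq_or_ne ξ 0 with rfl | hξ
  · exact ⟨0, map_zero _⟩
  have hn : ‖ξ‖ ≠ 0 := mt (ContinuousLinearMap.opNorm_zero_iff ξ).1 hξ
  obtain ⟨v, hv⟩ := key (‖ξ‖⁻¹ • ξ) (by
    refine (ContinuousLinearMap.opNorm_smul_le _ _).trans ?_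
    rw [norm_inv, Real.norm_of_nonneg (ContinuousLinearMap.opNorm_nonneg ξ), inv_mul_cancel₀ hn])
  refine ⟨‖ξ‖ • v, ?_⟩
  rw [map_smul, hv, smul_smul, mul_inv_cancel₀ hn, one_smul]

/-- V is isometric to its bidual, which is complete. -/
theorem FlowDuality.IsReflexiveSpace.completeSpace {V : Type*} [NormedAddCommGroup V]
    [NormedSpace ℝ V] (h : FlowDuality.IsReflexiveSpace V) : CompleteSpace V :=
  (LinearIsometryEquiv.ofSurjective (NormedSpace.inclusionInDoubleDualLi (E := V) ℝ)
    h).toIsometryEquiv.completeSpace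

/-! ### The ℓ² interpolation space -/

/-- A sequence of seminorms on `E` that dominate the norm and are equivalent to it. -/
structure SeminormScale (E : Type*) [NormedAddCommGroup E] [NormedSpace ℝ E] where
  /-- The seminorms of the scale. -/
  q : ℕ → Seminorm ℝ E
  le_q : ∀ n f, ‖f‖ ≤ q n f
  /-- The constants by which the seminorms are bounded. -/
  bound : ℕ → ℝ
  q_le : ∀ n f, q n f ≤ bound n * ‖f‖

namespace SeminormScale

/-- Weights whose squares `2 ^ (-(n + 1))` add up to one. -/
noncomputable def weight (n : ℕ) : ℝ := √(1 / 2 / 2 ^ n)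

theorem weight_nonneg (n : ℕ) : 0 ≤ weight n := Real.sqrt_nonneg _

theorem weight_sq (n : ℕ) : weight n ^ 2 = 1 / 2 / 2 ^ n := Real.sq_sqrt (by positivity)

theorem hasSum_weight_sq : HasSum (fun n => weight n ^ 2) 1 := by
  simpa only [weight_sq] using hasSum_geometric_two' 1

variable {E : Type*} [NormedAddCommGroup E] [NormedSpace ℝ E] (P : SeminormScale E)

/-- The weighted seminorms. -/
noncomputable def coord (n : ℕ) (f : E) : ℝ := weight n * P.q n f

theorem coord_nonneg (n : ℕ) (f : E) : 0 ≤ P.coord n f :=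
  mul_nonneg (weight_nonneg n) (apply_nonneg _ _)

theorem coord_add_le (n : ℕ) (f g : E) : P.coord n (f + g) ≤ P.coord n f + P.coord n g := by
  rw [coord, coord, coord, ← mul_add]
  exact mul_le_mul_of_nonneg_left (map_add_le_add _ _ _) (weight_nonneg n)

theorem coord_smul (n : ℕ) (c : ℝ) (f : E) : P.coord n (c • f) = |c| * P.coord n f := by
  rw [coord, coord, map_smul_eq_mul, Real.norm_eq_abs]; ring

theorem coord_zero (n : ℕ) : P.coord n 0 = 0 := by simp [coord]

theorem coord_le (n : ℕ) (f : E) : P.coord n f ≤ weight n * P.bound n * ‖f‖ := by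
  rw [mul_assoc]
  exact mul_le_mul_of_nonneg_left (P.q_le n f) (weight_nonneg n)

theorem continuous_q (n : ℕ) : Continuous (P.q n) := by
  refine Seminorm.continuous_of_le (p := P.q n)
    (q := (P.bound n).toNNReal • normSeminorm ℝ E) ?_ ?_
  · exact continuous_norm.const_smul (P.bound n).toNNReal
  · intro f
    exact (P.q_le n f).trans (mul_le_mul_of_nonneg_right (Real.le_coe_toNNReal _) (norm_nonneg _))

theorem continuous_coord (n : ℕ) : Continuous (P.coord n) :=
  continuous_const.mul (P.continuous_q n)

/-- The vectors with square summable weighted seminorms. -/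
def carrier : Submodule ℝ E where
  carrier := {f | Summable fun n => P.coord n f ^ 2}
  zero_mem' := by simp [coord_zero, summable_zero]
  add_mem' := by
    intro f g hf hg
    refine Summable.of_nonneg_of_le (fun n => sq_nonneg _) (fun n => ?_)
      ((hf.mul_left 2).add (hg.mul_left 2))
    have h := P.coord_add_le n f g
    have h0 := P.coord_nonneg n (f + g)
    nlinarith [sq_nonneg (P.coord n f - P.coord n g)]
  smul_mem' := by
    intro c f hf
    simpa only [Set.mem_ofPred_eq, coord_smul, mul_pow] using hf.mul_left _

theorem mem_carrier {f : E} : f ∈ P.carrier ↔ Summable fun n => P.coord n f ^ 2 := Iff.rfl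

/-- The `ℓ²` interpolation space of Davis, Figiel, Johnson and Pełczyński. -/
def Interp : Type _ := P.carrier

noncomputable instance : AddCommGroup P.Interp := inferInstanceAs (AddCommGroup P.carrier)

noncomputable instance : Module ℝ P.Interp := inferInstanceAs (Module ℝ P.carrier)

/-- The inclusion of the interpolation space. -/
noncomputable def incl : P.Interp →ₗ[ℝ] E := P.carrier.subtype

/-- An element of the interpolation space from a vector of `E`. -/
def ofMem {f : E} (hf : f ∈ P.carrier) : P.Interp := ⟨f, hf⟩

@[simp] theorem incl_ofMem {f : E} (hf : f ∈ P.carrier) : P.incl (P.ofMem hf) = f := rfl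

theorem incl_mem (v : P.Interp) : P.incl v ∈ P.carrier := v.2

theorem incl_injective : Function.Injective P.incl := Subtype.val_injective

/-- The sequence of weighted seminorms of a vector. -/
noncomputable def seq (v : P.Interp) : lp (fun _ : ℕ => ℝ) 2 :=
  ⟨fun n => P.coord n (P.incl v), memℓp_gen (by
    simpa using P.mem_carrier.1 (P.incl_mem v))⟩

theorem seq_apply (v : P.Interp) (n : ℕ) : P.seq v n = P.coord n (P.incl v) := rfl

noncomputable instance : Norm P.Interp := ⟨fun v => ‖P.seq v‖⟩

theorem norm_def (v : P.Interp) : ‖v‖ = ‖P.seq v‖ := rfl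

theorem norm_sq_eq (v : P.Interp) : ‖v‖ ^ 2 = ∑' n, P.coord n (P.incl v) ^ 2 := by
  have := lp.norm_rpow_eq_tsum (p := 2) (by simp) (P.seq v)
  simpa [seq_apply, norm_def] using this

/-- `seq` is not linear, but it is subadditive in each coordinate with nonnegative entries, and the
ℓ² norm is monotone. -/
theorem seq_add_norm_le (u v : P.Interp) : ‖P.seq (u + v)‖ ≤ ‖P.seq u + P.seq v‖ := by
  refine lp.norm_mono two_ne_zero fun n => ?_
  rw [lp.coeFn_add, Pi.add_apply]
  simp only [seq_apply, map_add]
  rw [Real.norm_of_nonneg (P.coord_nonneg _ _), Real.norm_of_nonneg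
    (add_nonneg (P.coord_nonneg _ _) (P.coord_nonneg _ _))]
  exact P.coord_add_le _ _ _

theorem norm_incl_le (v : P.Interp) : ‖P.incl v‖ ≤ ‖v‖ := by
  have h0 : 0 ≤ ‖v‖ := norm_nonneg (P.seq v)
  refine le_of_sq_le_sq ?_ h0
  rw [norm_sq_eq, ← one_mul (‖P.incl v‖ ^ 2), ← hasSum_weight_sq.tsum_eq, ← tsum_mul_right]
  refine (hasSum_weight_sq.summable.mul_right _).tsum_le_tsum (fun n => ?_)
    (P.mem_carrier.1 (P.incl_mem v))
  rw [← mul_pow]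
  exact pow_le_pow_left₀ (mul_nonneg (weight_nonneg n) (norm_nonneg _))
    (mul_le_mul_of_nonneg_left (P.le_q n _) (weight_nonneg n)) 2

theorem core : NormedSpace.Core ℝ P.Interp where
  norm_nonneg v := norm_nonneg (P.seq v)
  norm_smul c v := by
    have : P.seq (c • v) = |c| • P.seq v := by
      ext n
      simp [seq_apply, coord_smul]
    rw [norm_def, this, norm_smul, norm_def]
    simp
  norm_triangle u v := (P.seq_add_norm_le u v).trans (norm_add_le _ _)
  norm_eq_zero_iff v := by
    constructor
    · intro h
      have h1 := P.norm_incl_le v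
      rw [h] at h1
      exact P.incl_injective (by rw [norm_le_zero_iff.1 h1, map_zero])
    · rintro rfl
      have : P.seq 0 = 0 := by ext n; simp [seq_apply, coord_zero]
      rw [norm_def, this, norm_zero]

noncomputable instance : NormedAddCommGroup P.Interp := NormedAddCommGroup.ofCore P.core

noncomputable instance : NormedSpace ℝ P.Interp := NormedSpace.ofCore P.core

theorem coord_le_norm (v : P.Interp) (n : ℕ) : P.coord n (P.incl v) ≤ ‖v‖ :=
  (le_abs_self _).trans (lp.norm_apply_le_norm two_ne_zero (P.seq v) n)

/-- Finite partial sums are continuous on `E`, so this criterion survives passage to closures. -/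
theorem norm_le_of_sum_le {f : E} (h : ∀ s : Finset ℕ, ∑ n ∈ s, P.coord n f ^ 2 ≤ 1) :
    ∃ hf : f ∈ P.carrier, ‖P.ofMem hf‖ ≤ 1 := by
  have hf : f ∈ P.carrier := summable_of_sum_le (fun n => sq_nonneg _) h
  refine ⟨hf, ?_⟩
  refine le_of_sq_le_sq ?_ zero_le_one
  rw [norm_sq_eq, one_pow]
  exact Summable.tsum_le_of_sum_le hf h

end SeminormScale

/-! ### Weak compactness of the unit ball -/

namespace SeminormScale

variable {E : Type*} [NormedAddCommGroup E] [NormedSpace ℝ E] (P : SeminormScale E)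

open scoped InnerProductSpace

/-- Up to a small ℓ² error, `seq w` has finitely many coordinates, and in those `u` is controlled by
its norm in `E`. -/
theorem exists_inner_seq_le (w : P.Interp) (R : ℝ) {η : ℝ} (hη : 0 < η) :
    ∃ δ > 0, ∀ u : P.Interp, ‖u‖ ≤ R → ‖P.incl u‖ ≤ δ → ⟪P.seq w, P.seq u⟫_ℝ ≤ η := by
  classical
  let R' := max R 0 + 1
  have hR' : 0 < R' := by positivity
  have hs := lp.hasSum_single (p := 2) (by simp) (P.seq w)
  obtain ⟨s, hs⟩ := (Metric.tendsto_nhds.1 hs (η / (2 * R')) (by positivity)).exists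
  set a := ∑ i ∈ s, lp.single 2 i (P.seq w i) with ha
  rw [dist_comm, dist_eq_norm] at hs
  let M := ∑ i ∈ s, P.coord i (P.incl w) * (weight i * |P.bound i|)
  have hM : 0 ≤ M := Finset.sum_nonneg fun i _ =>
    mul_nonneg (P.coord_nonneg _ _) (mul_nonneg (weight_nonneg i) (abs_nonneg _))
  refine ⟨η / (2 * (M + 1)), by positivity, fun u hu hδ => ?_⟩
  have h1 : ⟪P.seq w - a, P.seq u⟫_ℝ ≤ η / 2 := by
    refine (real_inner_le_norm _ _).trans ?_
    have hu' : ‖P.seq u‖ ≤ R' := (hu.trans (le_max_left R 0)).trans (by simp [R'])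
    calc ‖P.seq w - a‖ * ‖P.seq u‖ ≤ (η / (2 * R')) * R' := by gcongr
      _ = η / 2 := by field_simp
  have h2 : ⟪a, P.seq u⟫_ℝ ≤ η / 2 := by
    rw [ha, sum_inner]
    calc ∑ i ∈ s, ⟪lp.single 2 i (P.seq w i), P.seq u⟫_ℝ
        ≤ ∑ i ∈ s, P.coord i (P.incl w) * (weight i * |P.bound i|) * ‖P.incl u‖ := by
          refine Finset.sum_le_sum fun i _ => ?_
          rw [lp.inner_single_left, real_inner_comm]
          change P.coord i (P.incl w) * P.coord i (P.incl u) ≤ _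
          rw [mul_assoc]
          refine mul_le_mul_of_nonneg_left ((P.coord_le i _).trans ?_) (P.coord_nonneg _ _)
          have := weight_nonneg i
          gcongr
          exact le_abs_self _
      _ = M * ‖P.incl u‖ := by rw [← Finset.sum_mul]
      _ ≤ (M + 1) * (η / (2 * (M + 1))) := by gcongr; linarith
      _ = η / 2 := by field_simp
  calc ⟪P.seq w, P.seq u⟫_ℝ = ⟪P.seq w - a, P.seq u⟫_ℝ + ⟪a, P.seq u⟫_ℝ := by
        rw [← inner_add_left, sub_add_cancel]
    _ ≤ η := by linarith

/-- On bounded sets of the interpolation space, a functional is small at vectors that are small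
in `E`. -/
theorem exists_strongDual_lt (φ : StrongDual ℝ P.Interp) (R : ℝ) {ε : ℝ} (hε : 0 < ε) :
    ∃ δ > 0, ∀ u : P.Interp, ‖u‖ ≤ R → ‖P.incl u‖ ≤ δ → φ u < ε := by
  by_contra! hcon
  have key : ∀ m : ℕ, ∃ w : P.Interp, m * ε ≤ φ w ∧ ‖w‖ ^ 2 ≤ m * (R ^ 2 + 1) := by
    intro m
    induction m with
    | zero => exact ⟨0, by simp, by simp⟩
    | succ m ih =>
      obtain ⟨w, hw1, hw2⟩ := ih
      obtain ⟨δ, hδ, h⟩ := P.exists_inner_seq_le w R (η := 1 / 2) (by norm_num)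
      obtain ⟨u, hu1, hu2, hu3⟩ := hcon δ hδ
      have hin := h u hu1 hu2
      refine ⟨w + u, ?_, ?_⟩
      · rw [map_add]; push_cast; linarith
      · have h1 : ‖w + u‖ ^ 2 ≤ ‖P.seq w + P.seq u‖ ^ 2 :=
          pow_le_pow_left₀ (norm_nonneg _) (P.seq_add_norm_le w u) 2
        rw [norm_add_sq_real (P.seq w)] at h1
        have h2 : ‖P.seq u‖ ^ 2 ≤ R ^ 2 := pow_le_pow_left₀ (norm_nonneg _) hu1 2
        have h3 : ‖P.seq w‖ ^ 2 = ‖w‖ ^ 2 := rfl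
        push_cast
        linarith
  obtain ⟨m, hm⟩ := exists_nat_gt (‖φ‖ ^ 2 * (R ^ 2 + 1) / ε ^ 2)
  obtain ⟨w, hw1, hw2⟩ := key m
  rw [div_lt_iff₀ (by positivity)] at hm
  have hm0 : (0 : ℝ) < m := by
    by_contra h0
    have : (m : ℝ) = 0 := le_antisymm (not_lt.1 h0) (Nat.cast_nonneg m)
    rw [this, zero_mul] at hm
    have : 0 ≤ ‖φ‖ ^ 2 * (R ^ 2 + 1) := by positivity
    linarith
  have h1 : (m * ε) ^ 2 ≤ (‖φ‖ * ‖w‖) ^ 2 :=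
    pow_le_pow_left₀ (by positivity) (hw1.trans ((le_abs_self _).trans (φ.le_opNorm w))) 2
  have h2 : (‖φ‖ * ‖w‖) ^ 2 ≤ ‖φ‖ ^ 2 * (m * (R ^ 2 + 1)) := by
    rw [mul_pow]; gcongr
  have h3 : (m : ℝ) * (m * ε ^ 2) ≤ m * (‖φ‖ ^ 2 * (R ^ 2 + 1)) := by
    calc (m : ℝ) * (m * ε ^ 2) = (m * ε) ^ 2 := by ring
      _ ≤ _ := h1.trans h2
      _ = _ := by ring
  exact absurd (le_of_mul_le_mul_left h3 hm0) (not_le.2 hm)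

open Filter in
/-- If the vectors all of whose weighted seminorms are at most one form a relatively weakly compact
set, then the unit ball of the interpolation space is weakly compact. -/
theorem exists_tendsto_strongDual (hP : IsRelWeaklyCompact {f | ∀ n, P.coord n f ≤ 1})
    (U : Ultrafilter P.Interp) (hU : {v | ‖v‖ ≤ 1} ∈ U) :
    ∃ v : P.Interp, ‖v‖ ≤ 1 ∧ ∀ φ : StrongDual ℝ P.Interp, Tendsto φ U (𝓝 (φ v)) := by
  obtain ⟨κ, hκ⟩ := hP (U.map P.incl) (Ultrafilter.mem_map.2
    (mem_of_superset hU fun v hv n => (P.coord_le_norm v n).trans hv))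
  have hcl : ∀ C : Set P.Interp, Convex ℝ C → C ∈ U → κ ∈ closure (P.incl '' C) :=
    fun C hC hCU => mem_closure_of_tendsto_strongDual (l := U.map P.incl)
      (hC.linear_image P.incl) (image_mem_map hCU) hκ
  have hball : Convex ℝ {v : P.Interp | ‖v‖ ≤ 1} := by
    simpa [Metric.closedBall] using convex_closedBall (0 : P.Interp) 1
  obtain ⟨hκm, hκn⟩ := P.norm_le_of_sum_le (f := κ) (by
    intro s
    have hclosed : IsClosed {f : E | ∑ n ∈ s, P.coord n f ^ 2 ≤ 1} :=
      isClosed_le (continuous_finsetSum _ fun n _ => (P.continuous_coord n).pow 2)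
        continuous_const
    refine closure_minimal ?_ hclosed (hcl _ hball hU)
    rintro - ⟨v, hv, rfl⟩
    have h1 := (P.mem_carrier.1 (P.incl_mem v)).sum_le_tsum s (fun n _ => sq_nonneg _)
    rw [← P.norm_sq_eq] at h1
    exact h1.trans (pow_le_one₀ (norm_nonneg v) hv))
  refine ⟨P.ofMem hκm, hκn, ?_⟩
  set v := P.ofMem hκm with hv
  have half : ∀ (φ : StrongDual ℝ P.Interp) (ε : ℝ), 0 < ε → ∀ᶠ u in (U : Filter _),
      φ u - φ v < ε := by
    intro φ ε hε
    by_contra hn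
    have hge : {u | φ v + ε ≤ φ u} ∈ U := by
      rw [← Ultrafilter.eventually_not] at hn
      filter_upwards [hn] with u hu
      linarith
    -- By Mazur, κ is a norm limit in `E` of points of this convex set; such a point near κ differs
    -- from `v` by norm at most 2, so φ cannot exceed φ v by ε there.
    have hconv : Convex ℝ ({u | φ v + ε ≤ φ u} ∩ {u : P.Interp | ‖u‖ ≤ 1}) :=
      (convex_halfSpace_ge φ.toLinearMap.isLinear _).inter hball
    have hmem := hcl _ hconv (inter_mem hge hU)
    obtain ⟨δ, hδ, h⟩ := P.exists_strongDual_lt φ 2 hε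
    obtain ⟨-, ⟨u, ⟨hu1, hu2⟩, rfl⟩, hd⟩ := Metric.mem_closure_iff.1 hmem δ hδ
    have h1 : ‖u - v‖ ≤ 2 := (norm_sub_le _ _).trans (by
      have : ‖u‖ ≤ 1 := hu2
      linarith)
    have h2 := h (u - v) h1 (by
      rw [map_sub, ← dist_eq_norm, dist_comm]
      exact hd.le)
    rw [map_sub] at h2
    have hu1 : φ v + ε ≤ φ u := hu1
    linarith
  intro φ
  rw [Metric.tendsto_nhds]
  intro ε hε
  filter_upwards [half φ ε hε, half (-φ) ε hε] with u h1 h2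
  simp only [neg_apply] at h2
  rw [Real.dist_eq, abs_lt]
  constructor <;> linarith

theorem isReflexiveSpace (hP : IsRelWeaklyCompact {f | ∀ n, P.coord n f ≤ 1}) :
    FlowDuality.IsReflexiveSpace P.Interp :=
  FlowDuality.isReflexiveSpace_of_ultrafilter fun U hU =>
    let ⟨v, _, h⟩ := P.exists_tendsto_strongDual hP U hU
    ⟨v, h⟩

end SeminormScale

/-! ### The seminorm scale of a weakly compact set -/

open Filter in
/-- A set that is uniformly approximated by multiples of relatively weakly compact sets is
relatively weakly compact. -/
theorem IsRelWeaklyCompact.of_approx {E : Type*} [NormedAddCommGroup E] [NormedSpace ℝ E]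
    [CompleteSpace E] {K S : Set E} (hK : IsRelWeaklyCompact K)
    (h : ∀ ε > 0, ∃ M : ℝ, ∀ f ∈ S, ∃ k ∈ K, ‖f - M • k‖ ≤ ε) : IsRelWeaklyCompact S := by
  intro U hU
  have step : ∀ ε > 0, ∃ (g : E → E) (z : E), (∀ᶠ f in (U : Filter E), ‖f - g f‖ ≤ ε) ∧
      ∀ ψ : StrongDual ℝ E, Tendsto (fun f => ψ (g f)) U (𝓝 (ψ z)) := by
    intro ε hε
    obtain ⟨M, hM⟩ := h ε hε
    have hex : ∀ f, ∃ k, f ∈ S → k ∈ K ∧ ‖f - M • k‖ ≤ ε := fun f => by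
      by_cases hf : f ∈ S
      · obtain ⟨k, hk⟩ := hM f hf
        exact ⟨k, fun _ => hk⟩
      · exact ⟨0, fun h => absurd h hf⟩
    choose k hk using hex
    obtain ⟨κ, hκ⟩ := hK (U.map k) (Ultrafilter.mem_map.2
      (mem_of_superset hU fun f hf => (hk f hf).1))
    refine ⟨fun f => M • k f, M • κ, ?_, fun ψ => ?_⟩
    · filter_upwards [hU] with f hf using (hk f hf).2
    · simp only [map_smul]
      have h1 : Tendsto (fun f => ψ (k f)) U (𝓝 (ψ κ)) := hκ ψ
      exact h1.const_smul M
  choose g z hg hz using fun n : ℕ => step (1 / ((n : ℝ) + 1)) Nat.one_div_pos_of_nat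
  -- Weak lower semicontinuity of the norm makes the weak limits of the approximants a Cauchy
  -- sequence.
  have hdist : ∀ n m, dist (z n) (z m) ≤ 1 / ((n : ℝ) + 1) + 1 / ((m : ℝ) + 1) := by
    intro n m
    rw [dist_eq_norm]
    refine NormedSpace.norm_le_dual_bound ℝ _ (by positivity) fun ψ => ?_
    have hlim := ((hz n ψ).sub (hz m ψ)).norm
    rw [map_sub]
    refine le_of_tendsto hlim ?_
    filter_upwards [hg n, hg m] with f h1 h2
    rw [← map_sub, mul_comm]
    refine (ψ.le_opNorm _).trans (mul_le_mul_of_nonneg_left ?_ (norm_nonneg _))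
    calc ‖g n f - g m f‖ = ‖(f - g m f) - (f - g n f)‖ := by congr 1; abel
      _ ≤ ‖f - g m f‖ + ‖f - g n f‖ := norm_sub_le _ _
      _ ≤ _ := by linarith
  have hlim0 : Tendsto (fun n : ℕ => 2 * (1 / ((n : ℝ) + 1))) atTop (𝓝 0) := by
    simpa using (tendsto_one_div_add_atTop_nhds_zero_nat (𝕜 := ℝ)).const_mul 2
  have hmono : ∀ N n : ℕ, N ≤ n → 1 / ((n : ℝ) + 1) ≤ 1 / ((N : ℝ) + 1) := fun N n h => by
    gcongr
  have hbd : ∀ n m N : ℕ, N ≤ n → N ≤ m → dist (z n) (z m) ≤ 2 * (1 / ((N : ℝ) + 1)) := by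
    intro n m N hn hm
    have := hdist n m
    have := hmono N n hn
    have := hmono N m hm
    linarith
  obtain ⟨κ, hκ⟩ := cauchySeq_tendsto_of_complete (cauchySeq_of_le_tendsto_0 _ hbd hlim0)
  have hzκ : ∀ n, dist (z n) κ ≤ 2 * (1 / ((n : ℝ) + 1)) := fun n =>
    le_of_tendsto (tendsto_const_nhds.dist hκ)
      ((eventually_ge_atTop n).mono fun m hm => hbd n m n le_rfl hm)
  refine ⟨κ, fun ψ => ?_⟩
  rw [Metric.tendsto_nhds]
  intro ε hε
  have h3 : Tendsto (fun n : ℕ => (‖ψ‖ + 1) * (2 * (1 / ((n : ℝ) + 1)))) atTop (𝓝 0) := by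
    simpa using hlim0.const_mul (‖ψ‖ + 1)
  obtain ⟨n, hn⟩ := (h3.eventually_lt_const (by positivity : (0 : ℝ) < ε / 3)).exists
  have hδ : 0 < 1 / ((n : ℝ) + 1) := Nat.one_div_pos_of_nat
  filter_upwards [hg n, Metric.tendsto_nhds.1 (hz n ψ) (ε / 3) (by positivity)] with f h1 h2
  have e1 : dist (ψ f) (ψ (g n f)) ≤ (‖ψ‖ + 1) * (2 * (1 / ((n : ℝ) + 1))) := by
    rw [dist_eq_norm, ← map_sub]
    refine (ψ.le_opNorm _).trans ?_
    gcongr <;> linarith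
  have e2 : dist (ψ (z n)) (ψ κ) ≤ (‖ψ‖ + 1) * (2 * (1 / ((n : ℝ) + 1))) := by
    rw [dist_eq_norm, ← map_sub]
    refine (ψ.le_opNorm _).trans ?_
    have := hzκ n
    rw [dist_eq_norm] at this
    gcongr
    linarith
  linarith [dist_triangle4 (ψ f) (ψ (g n f)) (ψ (z n)) (ψ κ)]

section Scale

open Metric Pointwise

variable {E : Type*} [NormedAddCommGroup E] [NormedSpace ℝ E] {K : Set E}

theorem balanced_of_convex_of_neg_mem (hconv : Convex ℝ K) (h0 : (0 : E) ∈ K)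
    (hneg : ∀ f ∈ K, -f ∈ K) : Balanced ℝ K := by
  rw [balanced_iff_smul_mem]
  intro c hc f hf
  rw [Real.norm_eq_abs] at hc
  rcases abs_cases c with ⟨h, h'⟩ | ⟨h, h'⟩
  · exact hconv.smul_mem_of_zero_mem h0 hf ⟨h', by linarith⟩
  · have := hneg _ (hconv.smul_mem_of_zero_mem h0 hf (t := -c) ⟨by linarith, by linarith⟩)
    simpa using this

/-- The convex combination of `K` and the unit ball with weight `t` on the unit ball. -/
def thicken (K : Set E) (t : ℝ) : Set E := (1 - t) • K + t • closedBall (0 : E) 1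

theorem convex_thicken (hconv : Convex ℝ K) (t : ℝ) : Convex ℝ (thicken K t) :=
  (hconv.smul _).add ((convex_closedBall _ _).smul _)

theorem balanced_thicken (hbal : Balanced ℝ K) (t : ℝ) : Balanced ℝ (thicken K t) :=
  (hbal.smul _).add (balanced_closedBall_zero.smul _)

theorem closedBall_subset_thicken (h0 : (0 : E) ∈ K) {t : ℝ} (ht : 0 < t) :
    closedBall (0 : E) t ⊆ thicken K t := by
  intro f hf
  refine ⟨0, ⟨0, h0, smul_zero _⟩, f, ⟨t⁻¹ • f, ?_, ?_⟩, zero_add _⟩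
  · rw [mem_closedBall_zero_iff] at hf ⊢
    rw [norm_smul, norm_inv, Real.norm_of_nonneg ht.le, inv_mul_le_one₀ ht]
    exact hf
  · exact smul_inv_smul₀ ht.ne' f

theorem absorbent_thicken (h0 : (0 : E) ∈ K) {t : ℝ} (ht : 0 < t) : Absorbent ℝ (thicken K t) :=
  (absorbent_nhds_zero (closedBall_mem_nhds (0 : E) ht)).mono (closedBall_subset_thicken h0 ht)

theorem thicken_subset_closedBall (hK : K ⊆ closedBall 0 1) {t : ℝ} (ht : 0 ≤ t) (ht1 : t ≤ 1) :
    thicken K t ⊆ closedBall (0 : E) 1 := by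
  rintro - ⟨-, ⟨k, hk, rfl⟩, -, ⟨b, hb, rfl⟩, rfl⟩
  exact convex_closedBall (0 : E) 1 (hK hk) hb (by linarith) ht (by ring)

theorem subset_thicken (hK : K ⊆ closedBall 0 1) (t : ℝ) : K ⊆ thicken K t := by
  intro k hk
  refine ⟨(1 - t) • k, ⟨k, hk, rfl⟩, t • k, ⟨k, hK hk, rfl⟩, ?_⟩
  change (1 - t) • k + t • k = k
  rw [← add_smul, sub_add_cancel, one_smul]

theorem map_thicken {T : E →ₗ[ℝ] E} (hT : ∀ f, ‖T f‖ ≤ ‖f‖) (hTK : ∀ f ∈ K, T f ∈ K) {t : ℝ}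
    {f : E} (hf : f ∈ thicken K t) : T f ∈ thicken K t := by
  obtain ⟨-, ⟨k, hk, rfl⟩, -, ⟨b, hb, rfl⟩, rfl⟩ := hf
  refine ⟨(1 - t) • T k, ⟨T k, hTK k hk, rfl⟩, t • T b, ⟨T b, ?_, rfl⟩, by simp⟩
  rw [mem_closedBall_zero_iff] at hb ⊢
  exact (hT b).trans hb

/-- The proportion of the unit ball used in the `n`-th seminorm. -/
noncomputable def mixing (n : ℕ) : ℝ := 1 / 8 ^ (n + 1)

theorem mixing_pos (n : ℕ) : 0 < mixing n := by unfold mixing; positivity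

theorem mixing_le_one (n : ℕ) : mixing n ≤ 1 := by
  unfold mixing
  rw [div_le_one (by positivity)]
  exact one_le_pow₀ (by norm_num)

/-- The gauges of the sets interpolating between `K` and the unit ball. -/
noncomputable def SeminormScale.ofSet (hconv : Convex ℝ K) (h0 : (0 : E) ∈ K)
    (hneg : ∀ f ∈ K, -f ∈ K) (hK : K ⊆ closedBall 0 1) : SeminormScale E where
  q n := gaugeSeminorm (balanced_thicken (balanced_of_convex_of_neg_mem hconv h0 hneg) (mixing n))
    (convex_thicken hconv (mixing n)) (absorbent_thicken h0 (mixing_pos n))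
  le_q n f := by
    change ‖f‖ ≤ gauge (thicken K (mixing n)) f
    have h := gauge_mono (absorbent_thicken h0 (mixing_pos n))
      (thicken_subset_closedBall hK (mixing_pos n).le (mixing_le_one n)) f
    rwa [gauge_closedBall zero_le_one, div_one] at h
  bound n := 1 / mixing n
  q_le n f := by
    change gauge (thicken K (mixing n)) f ≤ _
    have h := gauge_mono (absorbent_nhds_zero (closedBall_mem_nhds (0 : E) (mixing_pos n)))
      (closedBall_subset_thicken h0 (mixing_pos n)) f
    rw [gauge_closedBall (mixing_pos n).le] at h
    rwa [one_div_mul_eq_div]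

namespace SeminormScale

variable (hconv : Convex ℝ K) (h0 : (0 : E) ∈ K) (hneg : ∀ f ∈ K, -f ∈ K)
  (hK : K ⊆ closedBall 0 1)

theorem ofSet_q (n : ℕ) (f : E) :
    (ofSet hconv h0 hneg hK).q n f = gauge (thicken K (mixing n)) f := rfl

theorem ofSet_coord_le_weight {f : E} (hf : f ∈ K) (n : ℕ) :
    (ofSet hconv h0 hneg hK).coord n f ≤ weight n := by
  refine mul_le_of_le_one_right (weight_nonneg n) ?_
  exact gauge_le_one_of_mem (subset_thicken hK _ hf)

theorem ofSet_norm_le_one {f : E} (hf : f ∈ K) :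
    ∃ h : f ∈ (ofSet hconv h0 hneg hK).carrier, ‖(ofSet hconv h0 hneg hK).ofMem h‖ ≤ 1 := by
  refine norm_le_of_sum_le _ fun s => ?_
  calc ∑ n ∈ s, (ofSet hconv h0 hneg hK).coord n f ^ 2 ≤ ∑ n ∈ s, weight n ^ 2 :=
        Finset.sum_le_sum fun n _ => pow_le_pow_left₀ (coord_nonneg _ _ _)
          (ofSet_coord_le_weight hconv h0 hneg hK hf n) 2
    _ ≤ 1 := sum_le_hasSum s (fun n _ => sq_nonneg _) hasSum_weight_sq

/-- T preserves every thickened set, so it cannot increase their gauges. -/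
theorem ofSet_coord_map_le {T : E →ₗ[ℝ] E} (hT : ∀ f, ‖T f‖ ≤ ‖f‖) (hTK : ∀ f ∈ K, T f ∈ K)
    (n : ℕ) (f : E) :
    (ofSet hconv h0 hneg hK).coord n (T f) ≤ (ofSet hconv h0 hneg hK).coord n f := by
  refine mul_le_mul_of_nonneg_left ?_ (weight_nonneg n)
  rw [ofSet_q, ofSet_q]
  refine le_of_forall_pos_lt_add fun ε hε => ?_
  obtain ⟨b, hb, hb', g, hg, rfl⟩ := exists_lt_of_gauge_lt
    (absorbent_thicken h0 (mixing_pos n)) (lt_add_of_pos_right (gauge _ f) hε)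
  refine lt_of_le_of_lt (gauge_le_of_mem hb.le ?_) hb'
  exact ⟨T g, map_thicken hT hTK hg, (map_smul T b g).symm⟩

/-- The n-th weight exceeds 2^-(n+1), so such an f has n-th gauge below 2^(n+1) and lies within
2^(n+1) · 8^-(n+1) = 4^-(n+1) of 2^(n+1) K. The base 8 makes this error vanish. -/
theorem ofSet_isRelWeaklyCompact [CompleteSpace E] (hcomp : IsRelWeaklyCompact K) :
    IsRelWeaklyCompact {f | ∀ n, (ofSet hconv h0 hneg hK).coord n f ≤ 1} := by
  refine hcomp.of_approx fun ε hε => ?_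
  obtain ⟨n, hn⟩ := exists_pow_lt_of_lt_one hε (by norm_num : (1 / 4 : ℝ) < 1)
  refine ⟨2 ^ (n + 1), fun f hf => ?_⟩
  have hw : (1 : ℝ) / 2 ^ (n + 1) < weight n := by
    refine lt_of_pow_lt_pow_left₀ 2 (weight_nonneg n) ?_
    rw [weight_sq, div_pow, one_pow, div_div, ← pow_succ', pow_two]
    exact one_div_lt_one_div_of_lt (by positivity)
      (lt_mul_of_one_lt_left (by positivity) (one_lt_pow₀ one_lt_two n.succ_ne_zero))
  have hq : gauge (thicken K (mixing n)) f < 2 ^ (n + 1) := by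
    by_contra! hge
    have h1 : weight n * gauge (thicken K (mixing n)) f ≤ 1 := hf n
    have h2 : (1 : ℝ) / 2 ^ (n + 1) * 2 ^ (n + 1) < weight n * gauge (thicken K (mixing n)) f :=
      mul_lt_mul hw hge (by positivity) (weight_nonneg n)
    rw [one_div_mul_cancel (by positivity)] at h2
    linarith
  obtain ⟨b, hb, hb', -, ⟨-, ⟨k, hk, rfl⟩, -, ⟨u, hu, rfl⟩, rfl⟩, rfl⟩ :=
    exists_lt_of_gauge_lt (absorbent_thicken h0 (mixing_pos n)) hq
  have ht := mixing_le_one n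
  have ht0 := mixing_pos n
  have h2 : (0 : ℝ) < 2 ^ (n + 1) := by positivity
  -- Shrinking `k` inside K allows one multiple 2^(n+1) for all f.
  refine ⟨(b * (1 - mixing n) / 2 ^ (n + 1)) • k, hconv.smul_mem_of_zero_mem h0 hk ⟨?_, ?_⟩, ?_⟩
  · exact div_nonneg (mul_nonneg hb.le (by linarith)) h2.le
  · rw [div_le_one h2]
    exact (mul_le_of_le_one_right hb.le (by linarith)).trans hb'.le
  · have e : b • ((1 - mixing n) • k + mixing n • u) -
        (2 : ℝ) ^ (n + 1) • (b * (1 - mixing n) / 2 ^ (n + 1)) • k = (b * mixing n) • u := by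
      rw [smul_smul, mul_div_cancel₀ _ h2.ne', smul_add, smul_smul, smul_smul]
      abel
    change ‖b • ((1 - mixing n) • k + mixing n • u) - _‖ ≤ ε
    rw [e, norm_smul, Real.norm_of_nonneg (by positivity)]
    rw [mem_closedBall_zero_iff] at hu
    calc b * mixing n * ‖u‖ ≤ 2 ^ (n + 1) * mixing n * 1 := by gcongr
      _ = (1 / 4) ^ (n + 1) := by
        rw [mixing, mul_one, mul_one_div, ← div_pow]; norm_num
      _ ≤ (1 / 4) ^ n := pow_le_pow_of_le_one (by norm_num) (by norm_num) n.le_succ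
      _ ≤ ε := hn.le

end SeminormScale

end Scale

/-! ### Operators, functionals and convergence in the interpolation space -/

namespace SeminormScale

variable {E : Type*} [NormedAddCommGroup E] [NormedSpace ℝ E] (P : SeminormScale E)

theorem mem_carrier_of_coord_le {f g : E} (hg : g ∈ P.carrier)
    (h : ∀ n, P.coord n f ≤ P.coord n g) : f ∈ P.carrier :=
  Summable.of_nonneg_of_le (fun _ => sq_nonneg _)
    (fun n => pow_le_pow_left₀ (P.coord_nonneg n f) (h n) 2) hg

theorem norm_le_norm_of_coord_le {u v : P.Interp}
    (h : ∀ n, P.coord n (P.incl u) ≤ P.coord n (P.incl v)) : ‖u‖ ≤ ‖v‖ := by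
  refine lp.norm_mono two_ne_zero fun n => ?_
  rw [seq_apply, seq_apply, Real.norm_of_nonneg (P.coord_nonneg _ _),
    Real.norm_of_nonneg (P.coord_nonneg _ _)]
  exact h n

/-- A linear map that contracts every weighted seminorm acts on the interpolation space. -/
noncomputable def lift (T : E →ₗ[ℝ] E) (hT : ∀ n f, P.coord n (T f) ≤ P.coord n f) :
    P.Interp →L[ℝ] P.Interp :=
  LinearMap.mkContinuous
    { toFun := fun v => P.ofMem (P.mem_carrier_of_coord_le (P.incl_mem v) fun n => hT n (P.incl v))
      map_add' := fun u v => P.incl_injective (by simp)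
      map_smul' := fun c v => P.incl_injective (by simp) } 1
    fun v => by
      rw [one_mul]
      exact P.norm_le_norm_of_coord_le fun n => hT n (P.incl v)

theorem norm_lift_le (T : E →ₗ[ℝ] E) (hT : ∀ n f, P.coord n (T f) ≤ P.coord n f) :
    ‖P.lift T hT‖ ≤ 1 :=
  LinearMap.mkContinuous_norm_le _ zero_le_one _

/-- A functional on `E` of norm at most one, restricted to the interpolation space. -/
noncomputable def restrict (ψ : StrongDual ℝ E) (hψ : ‖ψ‖ ≤ 1) : StrongDual ℝ P.Interp :=
  LinearMap.mkContinuous (ψ.toLinearMap.comp P.incl) 1 fun v => by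
    exact (ψ.le_opNorm _).trans (mul_le_mul hψ (P.norm_incl_le v) (norm_nonneg _) zero_le_one)

theorem norm_restrict_le (ψ : StrongDual ℝ E) (hψ : ‖ψ‖ ≤ 1) : ‖P.restrict ψ hψ‖ ≤ 1 :=
  LinearMap.mkContinuous_norm_le _ zero_le_one _

open Filter in
/-- Convergence in `E` with uniform domination of the weighted seminorms implies convergence in
the interpolation space. -/
theorem tendsto_of_tendsto_incl {ι : Type*} {l : Filter ι} {u : ι → P.Interp} {v w : P.Interp}
    (h : Tendsto (fun i => P.incl (u i)) l (𝓝 (P.incl v)))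
    (hu : ∀ i n, P.coord n (P.incl (u i)) ≤ P.coord n (P.incl w))
    (hv : ∀ n, P.coord n (P.incl v) ≤ P.coord n (P.incl w)) : Tendsto u l (𝓝 v) := by
  rw [tendsto_iff_norm_sub_tendsto_zero]
  have hsq : Tendsto (fun i => ‖u i - v‖ ^ 2) l (𝓝 0) := by
    simp only [norm_sq_eq]
    rw [← tsum_zero (α := ℝ) (β := ℕ)]
    refine tendsto_tsum_of_dominated_convergence
      (bound := fun n => (2 * P.coord n (P.incl w)) ^ 2) ?_ (fun n => ?_) ?_
    · simp only [mul_pow]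
      exact (P.mem_carrier.1 (P.incl_mem w)).mul_left _
    · have h1 : Tendsto (fun i => P.incl (u i) - P.incl v) l (𝓝 0) := by
        simpa using h.sub_const (P.incl v)
      have h2 := (((P.continuous_coord n).tendsto 0).comp h1).pow 2
      simpa [P.coord_zero] using h2
    · refine Eventually.of_forall fun i n => ?_
      rw [Real.norm_of_nonneg (sq_nonneg _)]
      refine pow_le_pow_left₀ (P.coord_nonneg _ _) ?_ 2
      rw [map_sub, sub_eq_add_neg]
      refine (P.coord_add_le n _ _).trans ?_
      rw [← neg_one_smul ℝ, P.coord_smul]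
      have := hu i n
      have := hv n
      simp only [abs_neg, abs_one, one_mul]
      linarith
  simpa using hsq.sqrt

end SeminormScale

open Filter in
/-- If the unit ball is weakly compact, its weak topology is determined by any separating family of
functionals. -/
theorem continuous_strongDual_of_separating {V ι Z : Type*} [NormedAddCommGroup V]
    [NormedSpace ℝ V] [TopologicalSpace Z]
    (hV : ∀ U : Ultrafilter V, {v | ‖v‖ ≤ 1} ∈ U →
      ∃ v : V, ‖v‖ ≤ 1 ∧ ∀ φ : StrongDual ℝ V, Tendsto φ U (𝓝 (φ v)))
    {δ : ι → StrongDual ℝ V} (hδ : ∀ u v, (∀ i, δ i u = δ i v) → u = v) {g : Z → V} {R : ℝ}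
    (hg : ∀ z, ‖g z‖ ≤ R) (hcont : ∀ i, Continuous fun z => δ i (g z)) (φ : StrongDual ℝ V) :
    Continuous fun z => φ (g z) := by
  rcases isEmpty_or_nonempty Z with hZ | ⟨⟨z₁⟩⟩
  · exact continuous_of_const fun z => hZ.elim z
  have hR : 0 < R + 1 := by linarith [(norm_nonneg _).trans (hg z₁)]
  rw [continuous_iff_continuousAt]
  intro z₀
  rw [ContinuousAt, tendsto_iff_ultrafilter]
  intro W hW
  obtain ⟨v, -, hv⟩ := hV (W.map fun z => (R + 1)⁻¹ • g z) (Ultrafilter.mem_map.2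
    (Filter.univ_mem' fun z => by
      change ‖(R + 1)⁻¹ • g z‖ ≤ 1
      rw [norm_smul, norm_inv, Real.norm_of_nonneg hR.le, inv_mul_le_one₀ hR]
      linarith [hg z]))
  have hv' : ∀ χ : StrongDual ℝ V, Tendsto (fun z => χ (g z)) W (𝓝 ((R + 1) * χ v)) := by
    intro χ
    have h1 : Tendsto (fun z => χ ((R + 1)⁻¹ • g z)) W (𝓝 (χ v)) := hv χ
    refine (h1.const_mul (R + 1)).congr fun z => ?_
    rw [map_smul, smul_eq_mul, mul_inv_cancel_left₀ hR.ne']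
  -- The separating functionals identify the weak cluster point; scaling by R + 1, not R, covers R =
  -- 0.
  have heq : (R + 1) • v = g z₀ := hδ _ _ fun i => by
    rw [map_smul]
    exact tendsto_nhds_unique (hv' (δ i)) (((hcont i).tendsto z₀).mono_left hW)
  rw [← heq, map_smul]
  exact hv' φ

theorem norm_compCLM_le_one {X Y : Type*} [TopologicalSpace X] [CompactSpace X]
    [TopologicalSpace Y] [CompactSpace Y] (s : C(X, Y)) (f : C(Y, ℝ)) :
    ‖ContinuousMap.compCLM ℝ ℝ s f‖ ≤ ‖f‖ := by
  rw [ContinuousMap.norm_le _ (norm_nonneg _)]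
  exact fun x => f.norm_coe_le_norm (s x)

theorem norm_evalCLM_le_one {X : Type*} [TopologicalSpace X] [CompactSpace X] (x : X) :
    ‖(ContinuousMap.evalCLM ℝ x : StrongDual ℝ C(X, ℝ))‖ ≤ 1 :=
  ContinuousLinearMap.opNorm_le_bound _ zero_le_one fun f => by
    simpa using f.norm_coe_le_norm x

/-! ### The representation of the duality -/

theorem theorem4p3 {S : Type w} {X : Type u} {Y : Type v}
    [Semigroup S] [TopologicalSpace S] [SeparatelyContinuousMul S]
    [TopologicalSpace X] [CompactSpace X] [T2Space X]
    [TopologicalSpace Y] [CompactSpace Y] [T2Space Y]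
    [SemigroupAction S X] [SemigroupAction Sᵐᵒᵖ Y]
    (hX : FlowDuality.IsSemitopologicalFlow S X)
    (hY : FlowDuality.IsSemitopologicalFlow Sᵐᵒᵖ Y)
    (F : Y → X → ℝ) (hF : FlowDuality.IsStrictSDuality S F)
    (hF_mem : ∀ y x, F y x ∈ Set.Icc (-1 : ℝ) 1) :
    ∃ (V : Type u) (_ : NormedAddCommGroup V) (_ : NormedSpace ℝ V) (_ : CompleteSpace V)
      (h : S → FlowDuality.Theta V)
      (γ₂ : Y → FlowDuality.WeakBall V) (γ₁ : X → FlowDuality.WeakStarBall V),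
      FlowDuality.IsReflexiveSpace V ∧
      FlowDuality.IsAntihom h ∧
      (∀ e : S, FlowDuality.IsIdentity e → (∀ x : X, e • x = x) →
        (∀ y : Y, MulOpposite.op e • y = y) → (h e).1 = ContinuousLinearMap.id ℝ V) ∧
      FlowDuality.WeaklyContinuous h ∧
      FlowDuality.IsSRestriction F h γ₂ γ₁ ∧
      ((Continuous fun p : S × X => p.1 • p.2) → FlowDuality.StronglyContinuous h) := by

  let c : X → C(Y, ℝ) := fun x => ⟨fun y => F y x, hF.isDuality.continuous_left x⟩
  have hF1 : ∀ y x, |F y x| ≤ 1 := fun y x => abs_le.2 (hF_mem y x)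
  have hc : ∀ x, ‖c x‖ ≤ 1 := fun x => by
    rw [ContinuousMap.norm_le _ zero_le_one]
    exact fun y => hF1 y x
  have hKcomp : IsRelWeaklyCompact (weakHull c) := isRelWeaklyCompact_weakHull c
    (ContinuousMap.continuous_strongDual_apply c hF.isDuality.continuous_right
      fun x y => hF1 y x) hc
  have hK1 : weakHull c ⊆ Metric.closedBall 0 1 := fun f hf =>
    mem_closedBall_zero_iff.2 (norm_le_one_of_mem_weakHull hc hf)
  have hconv := convex_weakHull c
  have h0 := zero_mem_weakHull c
  have hneg : ∀ f ∈ weakHull c, -f ∈ weakHull c := fun f => neg_mem_weakHull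
  let P : SeminormScale C(X, ℝ) := SeminormScale.ofSet hconv h0 hneg hK1
  have hP := SeminormScale.ofSet_isRelWeaklyCompact hconv h0 hneg hK1 hKcomp
  have hrefl : FlowDuality.IsReflexiveSpace P.Interp := P.isReflexiveSpace hP
  have hball := P.exists_tendsto_strongDual hP
  let tX : S → C(X, X) := fun s => ⟨fun x => s • x, hX.continuous_translation s⟩
  let tY : S → C(Y, Y) := fun s =>
    ⟨fun y => MulOpposite.op s • y, hY.continuous_translation (MulOpposite.op s)⟩
  let T : S → C(X, ℝ) →ₗ[ℝ] C(X, ℝ) := fun s => (ContinuousMap.compCLM ℝ ℝ (tX s)).toLinearMap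
  -- Invariance of F reads c(sx) = c(x) ∘ (translation of Y by s), and composition with that
  -- translation is a contraction of C(Y).
  have hT : ∀ s n f, P.coord n (T s f) ≤ P.coord n f := fun s n f =>
    SeminormScale.ofSet_coord_map_le hconv h0 hneg hK1 (norm_compCLM_le_one (tX s))
      (fun f hf => comp_mem_weakHull hf (tX s) (ContinuousMap.compCLM ℝ ℝ (tY s))
        (ContinuousLinearMap.opNorm_le_bound _ zero_le_one fun g => by
          simpa using norm_compCLM_le_one (tY s) g)
        (fun x => by ext y; exact (hF.invariant s y x).symm)) n f
  let h : S → FlowDuality.Theta P.Interp := fun s => ⟨P.lift (T s) (hT s), P.norm_lift_le _ _⟩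
  have hh : ∀ s v x, P.incl ((h s).1 v) x = P.incl v (s • x) := fun s v x => rfl
  have hmem : ∀ y, (⟨F y, hF.isDuality.continuous_right y⟩ : C(X, ℝ)) ∈ weakHull c := fun y =>
    ⟨ContinuousMap.evalCLM ℝ y, norm_evalCLM_le_one y, fun x => rfl⟩
  choose hcar hnorm using fun y =>
    SeminormScale.ofSet_norm_le_one hconv h0 hneg hK1 (hmem y)
  let vec : Y → P.Interp := fun y => P.ofMem (hcar y)
  have hvec : ∀ y x, P.incl (vec y) x = F y x := fun y x => rfl
  let δ : X → StrongDual ℝ P.Interp := fun x =>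
    P.restrict (ContinuousMap.evalCLM ℝ x) (norm_evalCLM_le_one x)
  have hδ : ∀ x v, δ x v = P.incl v x := fun x v => rfl
  have hsep : ∀ u v, (∀ x, δ x u = δ x v) → u = v := fun u v huv =>
    P.incl_injective (ContinuousMap.ext huv)
  let γ₂ : Y → FlowDuality.WeakBall P.Interp := fun y => ⟨toWeakSpace ℝ P.Interp (vec y), hnorm y⟩
  let γ₁ : X → FlowDuality.WeakStarBall P.Interp := fun x =>
    ⟨StrongDual.toWeakDual (δ x), P.norm_restrict_le _ (norm_evalCLM_le_one x)⟩
  refine ⟨P.Interp, inferInstance, inferInstance, hrefl.completeSpace, h, γ₂, γ₁, hrefl,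
    ?_, ?_, ?_, ⟨?_, ?_, ?_, ?_, ?_⟩, ?_⟩
  · intro s t
    ext v
    refine P.incl_injective (ContinuousMap.ext fun x => ?_)
    rw [ContinuousLinearMap.comp_apply, hh, hh, hh, mul_smul]
  · intro e _ heX _
    ext v
    refine P.incl_injective (ContinuousMap.ext fun x => ?_)
    rw [hh, heX, ContinuousLinearMap.id_apply]
  · refine ContinuousLinearMapWOT.continuous_of_dual_apply_continuous fun v φ => ?_
    refine continuous_strongDual_of_separating hball hsep (g := fun s => (h s).1 v) (R := ‖v‖)
      (fun s => ((h s).1.le_of_opNorm_le (h s).2 v).trans_eq (one_mul _)) (fun x => ?_) φ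
    exact (P.incl v).continuous.comp (hX.continuous_orbit x)
  · have hcont : Continuous γ₂ := by
      refine Continuous.subtype_mk (WeakBilin.continuous_of_continuous_eval _ fun φ => ?_) _
      exact continuous_strongDual_of_separating hball hsep (g := vec) (R := 1) hnorm
        (fun x => hF.isDuality.continuous_left x) φ
    -- A continuous injection of a compact space into a Hausdorff one; strictness enters only
    -- through injectivity.
    refine (hcont.isClosedEmbedding fun y y' hyy => ?_).isEmbedding
    refine hF.left_strict.injective (funext fun x => ?_)
    have : vec y = vec y' := congrArg (fun z => (toWeakSpace ℝ P.Interp).symm z.1) hyy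
    rw [← hvec, this, hvec]
  · have hcont : Continuous γ₁ := by
      refine Continuous.subtype_mk (WeakDual.continuous_of_continuous_eval fun v => ?_) _
      exact (P.incl v).continuous
    refine (hcont.isClosedEmbedding fun x x' hxx => ?_).isEmbedding
    refine hF.right_strict.injective (funext fun y => ?_)
    exact congrArg (fun z => z.1 (vec y)) hxx
  · intro s y
    refine Subtype.ext (congrArg (toWeakSpace ℝ P.Interp) (?_ : vec _ = (h s).1 (vec y)))
    refine P.incl_injective (ContinuousMap.ext fun x => ?_)
    rw [hh, hvec, hvec, hF.invariant]
  · intro s x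
    refine Subtype.ext (congrArg StrongDual.toWeakDual (?_ : δ _ = (δ x).comp (h s).1))
    ext v
    rw [ContinuousLinearMap.comp_apply, hδ, hδ, hh]
  · exact fun y x => hvec y x
  · intro hjoint
    refine PointwiseConvergenceCLM.continuous_of_continuous_eval fun v => ?_
    rw [continuous_iff_continuousAt]
    intro s₀
    refine P.tendsto_of_tendsto_incl (w := v) ?_ (fun s n => hT s n _) (fun n => hT s₀ n _)
    -- Currying gives continuity for the compact-open topology, which is the norm topology as X is
    -- compact. The seminorms of all translates are dominated by those of `v`.
    have hcurry := (ContinuousMap.curry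
      ⟨fun p : S × X => P.incl v (p.1 • p.2), (P.incl v).continuous.comp hjoint⟩).continuous
    exact hcurry.tendsto s₀
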